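/- \textbf{Setting.} Let $V=(V,\bigvee,\otimes,k)$ be a commutative unital quantale with internal hom $x\otimes y\le z\iff x\le\hom(y,z)$. Let $\mathbb T=(T,m,e)$ be a monad on $\mathbf{Set}$ and $\xi:TV\to V$ a map such that $(\mathbb T,V,\xi)$ is a \emph{strict topological theory}: (a) $T$ sends pullbacks to weak pullbacks and the naturality squares of $m$ are weak pullbacks; (b) $(V,\xi)$ is a $\mathbb T$-algebra and $\otimes:V\times V\to V$, $k:1\to V$ are homomorphisms of $\mathbb T$-algebras; (c) the maps $V^X\to V^{TX}$, $\varphi\mapsto\xi\cdot T\varphi$, are monotone and natural in $X$ with respect to the direct images $f_!(\varphi)(y)=\bigvee_{f(x)=y}\varphi(x)$, i.e. $\xi\cdot T(f_!\varphi)=(Tf)_!(\xi\cdot T\varphi)$. Assume moreover $T1=1$. \textbf{$\mathcal T$-categories.} For $r:Y\times X\to V$ put $T_\xi r(\mathfrak y,\mathfrak x)=\bigvee\{\xi\cdot Tr(\mathfrak w)\mid \mathfrak w\in T(Y\times X),\,T\pi_1\mathfrak w=\mathfrak y,\,T\pi_2\mathfrak w=\mathfrak x\}$. A \emph{$\mathcal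 T$-graph} is a set $X$ with $a:TX\times X\to V$ such that $k\le a(e(x),x)$; it is a \emph{$\mathcal T$-category} if also $T_\xi a(\mathfrak X,\mathfrak x)\otimes a(\mathfrak x,x)\le a(m(\mathfrak X),x)$. A map $f:(X,a)\to(Y,b)$ is a \emph{morphism of $\mathcal T$-graphs} (a \emph{$\mathcal T$-functor}, between $\mathcal T$-categories) if $a(\mathfrak x,x)\le b(Tf(\mathfrak x),f(x))$. This defines the category $\mathcal T\text{-}\mathbf{Cat}$. The quantale $V$ is a $\mathcal T$-category with structure $\hom(\xi(\mathfrak v),v)$, and every $\mathbb T$-algebra $(I,\alpha)$ is a $\mathcal T$-graph (with value $k$ at $(\mathfrak i,i)$ if $\alpha(\mathfrak i)=i$, and $\bot$ otherwise). The underlying $V$-graph of a $\mathcal T$-graph $(A,a)$ is $[x,y]=a(e(x),y)$. \textbf{$\mathcal T$-frames.} Let $A$ be a $\mathcal T$-graph whose underlying $V$-graph is a $V$-category. A \emph{$\mathcal T$-weighted diagram} in $A$ consists of a set $I$ with a $\mathbb T$-algebra structure and a $V$-category structure, a $V$-functor $h:I\to A$ and a $V$-distributor $\psi:1\to I$ such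 that $i\mapsto\psi(i)\otimes h(i)$ is a morphism of $\mathcal T$-graphs $I\to A$ (where $\psi(i)\otimes h(i)$ is a tensor in $A$). A presheaf on $A$ is \emph{$\mathcal T$-generated} if it is of the form $h_*\cdot\psi$, that is $x\mapsto\bigvee_i[x,h(i)]\otimes\psi(i)$, for such a diagram. Write $PA$ for the $V$-category of presheaves on $A$. A \emph{$\mathcal T$-frame} is a $\mathcal T$-graph $A$ whose underlying $V$-graph is a complete $V$-category and such that for every $V$-distributor $\varphi:I\to 1$ and $V$-functor $h:I\to PA$ with all $h(i)$ $\mathcal T$-generated, if $\lim(\varphi,h)$ is $\mathcal T$-generated then $\sup_A(\lim(\varphi,h))=\lim(\varphi,\sup_A\cdot h)$ (up to equivalence in $A$). A \emph{$\mathcal T$-frame homomorphism} $f:A\to B$ is a $V$-functor between the underlying $V$-categories that preserves weighted limits and colimits of $\mathcal T$-weighted diagrams and is \emph{$\mathcal T$-compatible}: for each $\mathbb T$-algebra $I$ and each morphism of $\mathcal T$-graphs $D:I\to A$, the composite $f\cdot D$ is a morphism of $\mathcal T$-graphs. This defines the category $\mathcal T\text{-}\mathbf{Frm}$; the $\mathcal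 T$-graph $V$ is a $\mathcal T$-frame. \textbf{The functors.} The functor $\Omega:\mathcal T\text{-}\mathbf{Cat}^{\mathrm{op}}\to\mathcal T\text{-}\mathbf{Frm}$ sends $X=(X,a)$ to the set $V^X$ of $\mathcal T$-functors $X\to V$ with the structure $$(\mathfrak p,\varphi)\mapsto\bigwedge_{\substack{\mathfrak q\in T(X\times V^X),\,T\pi_2(\mathfrak q)=\mathfrak p\\ x\in X}}\hom\bigl(a(T\pi_1(\mathfrak q),x),\hom(\xi\cdot T\mathrm{ev}(\mathfrak q),\varphi(x))\bigr),$$ and sends $f$ to $\varphi\mapsto\varphi\cdot f$. The functor $\mathrm{pt}:\mathcal T\text{-}\mathbf{Frm}^{\mathrm{op}}\to\mathcal T\text{-}\mathbf{Cat}$ sends $A$ to the set of $\mathcal T$-frame homomorphisms $A\to V$ with the largest $\mathcal T$-category structure making all evaluations $h\mapsto h(x)$ ($x\in A$) $\mathcal T$-functors to $V$, namely $(\mathfrak p,h)\mapsto\bigwedge_{x\in A}\hom(\xi\cdot T\mathrm{ev}_x(\mathfrak p),h(x))$, and sends $f$ to $h\mapsto h\cdot f$. \textbf{Proposition.} There is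 a natural transformation $\eta:\mathrm{Id}\Rightarrow\mathrm{pt}\cdot\Omega$ of functors $\mathcal T\text{-}\mathbf{Cat}\to\mathcal T\text{-}\mathbf{Cat}$ whose components $\eta_X:X\to\mathrm{pt}(\Omega(X))$ send each $x\in X$ to the evaluation $\mathrm{ev}_{X,x}:\Omega(X)\to V$, $\varphi\mapsto\varphi(x)$. -/

import Mathlib

open CategoryTheory

open scoped Quantale

universe u

namespace TFrames

/-! ### Categories enriched in a commutative quantale

Throughout, `V` is a commutative unital quantale with tensor `*` and unit `1`, and
`y ⇨ₗ z = sSup {x | x * y ≤ z}` is its internal hom. -/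

section Enriched

variable {V : Type u} [CommMonoid V] [CompleteLattice V] [IsQuantale V]

theorem le_hom_iff {x y z : V} : x ≤ y ⇨ₗ z ↔ x * y ≤ z :=
  Quantale.leftMulResiduation_le_iff_mul_le

theorem hom_mul_le (y z : V) : (y ⇨ₗ z) * y ≤ z := le_hom_iff.1 le_rfl

theorem one_hom (z : V) : (1 : V) ⇨ₗ z = z :=
  le_antisymm (by simpa using hom_mul_le 1 z) (le_hom_iff.2 (by simp))

theorem hom_comp (x y z : V) : (x ⇨ₗ y) * (y ⇨ₗ z) ≤ x ⇨ₗ z := by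
  rw [le_hom_iff, mul_right_comm]
  exact (mul_le_mul_left (hom_mul_le x y) _).trans (by rw [mul_comm]; exact hom_mul_le y z)

theorem hom_curry (x y z : V) : (x * y) ⇨ₗ z = x ⇨ₗ (y ⇨ₗ z) := by
  refine eq_of_forall_le_iff fun c => ?_
  simp only [le_hom_iff, mul_assoc]

theorem hom_swap (x y z : V) : x ⇨ₗ (y ⇨ₗ z) = y ⇨ₗ (x ⇨ₗ z) := by
  rw [← hom_curry, ← hom_curry, mul_comm]

theorem hom_iInf {ι : Sort*} (x : V) (f : ι → V) : x ⇨ₗ (⨅ i, f i) = ⨅ i, x ⇨ₗ f i := by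
  refine eq_of_forall_le_iff fun c => ?_
  simp only [le_hom_iff, le_iInf_iff]

theorem iSup_hom {ι : Type*} (f : ι → V) (z : V) : (⨆ i, f i) ⇨ₗ z = ⨅ i, f i ⇨ₗ z := by
  refine eq_of_forall_le_iff fun c => ?_
  simp only [le_hom_iff, le_iInf_iff]
  rw [Quantale.mul_iSup_distrib, iSup_le_iff]

theorem hom_mono {x x' y y' : V} (hx : x' ≤ x) (hy : y ≤ y') : x ⇨ₗ y ≤ x' ⇨ₗ y' :=
  le_hom_iff.2 (((mul_le_mul_right hx _).trans (hom_mul_le x y)).trans hy)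

theorem one_le_hom {x y : V} : 1 ≤ x ⇨ₗ y ↔ x ≤ y := by rw [le_hom_iff, one_mul]

variable (V) in
/-- A `V`-category structure on the set `X`. -/
structure VCat (X : Type u) where
  hom : X → X → V
  refl : ∀ x, 1 ≤ hom x x
  trans : ∀ x y z, hom x y * hom y z ≤ hom x z

/-- `f` is a `V`-functor. -/
def IsVFunctor {X Y : Type u} (r : VCat V X) (s : VCat V Y) (f : X → Y) : Prop :=
  ∀ x y, r.hom x y ≤ s.hom (f x) (f y)

/-- `φ` is a `V`-distributor from `(X, r)` to the one-point `V`-category; such distributors are the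
weights for limits. -/
def IsLimitWeight {X : Type u} (r : VCat V X) (φ : X → V) : Prop :=
  ∀ x y, φ x * r.hom x y ≤ φ y

/-- `ψ` is a `V`-distributor from the one-point `V`-category to `(X, r)`; such distributors are the
(contravariant) presheaves on `(X, r)` and the weights for colimits. -/
def IsColimitWeight {X : Type u} (r : VCat V X) (ψ : X → V) : Prop :=
  ∀ x y, r.hom x y * ψ y ≤ ψ x

/-- `l` is a limit of `h` weighted by `φ`. -/
def IsWeightedLimit {I A : Type u} (s : VCat V A) (φ : I → V) (h : I → A) (l : A) : Prop :=
  ∀ a, s.hom a l = ⨅ i, φ i ⇨ₗ s.hom a (h i)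

/-- `c` is a colimit of `h` weighted by `ψ`. -/
def IsWeightedColimit {I A : Type u} (s : VCat V A) (ψ : I → V) (h : I → A) (c : A) : Prop :=
  ∀ a, s.hom c a = ⨅ i, ψ i ⇨ₗ s.hom (h i) a

/-- `t` is a tensor of `v : V` with `x`. -/
def IsTensor {A : Type u} (s : VCat V A) (v : V) (x t : A) : Prop :=
  ∀ a, s.hom t a = v ⇨ₗ s.hom x a

/-- The `V`-category has all (small) weighted limits. -/
def IsComplete {A : Type u} (s : VCat V A) : Prop :=
  ∀ (I : Type u) (r : VCat V I) (φ : I → V) (h : I → A),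
    IsLimitWeight r φ → IsVFunctor r s h → ∃ l, IsWeightedLimit s φ h l

/-- The set of presheaves on a `V`-category. -/
def Presheaf {A : Type u} (s : VCat V A) : Type u := {ψ : A → V // IsColimitWeight s ψ}

/-- The `V`-category of presheaves. -/
def presheafVCat {A : Type u} (s : VCat V A) : VCat V (Presheaf s) where
  hom ψ χ := ⨅ x, ψ.1 x ⇨ₗ χ.1 x
  refl _ := le_iInf fun _ => one_le_hom.2 le_rfl
  trans _ _ _ := le_iInf fun x =>
    (mul_le_mul' (iInf_le _ x) (iInf_le _ x)).trans (hom_comp _ _ _)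

/-- `c` is a supremum of the presheaf `ψ`, i.e. a colimit of the identity weighted by `ψ`. -/
def IsPresheafSup {A : Type u} (s : VCat V A) (ψ : Presheaf s) (c : A) : Prop :=
  IsWeightedColimit s ψ.1 id c

end Enriched

/-! ### Strict topological theories -/

/-- The action of a monad on functions. -/
def mmap (M : Monad (Type u)) {X Y : Type u} (f : X → Y) : M.obj X → M.obj Y :=
  fun t => M.map (↾f) t

/-- The unit of a monad, as a function. -/
def munit (M : Monad (Type u)) {X : Type u} : X → M.obj X := fun x => M.η.app X x

/-- The multiplication of a monad, as a function. -/
def mmul (M : Monad (Type u)) {X : Type u} : M.obj (M.obj X) → M.obj X := fun t => M.μ.app X t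

section MonadLemmas

variable (M : Monad (Type u)) {X Y Z : Type u}

theorem mmap_comp (g : Y → Z) (f : X → Y) (t : M.obj X) :
    mmap M g (mmap M f t) = mmap M (fun x => g (f x)) t := by
  have := ConcreteCategory.congr_hom (M.map_comp (↾f) (↾g)) t
  exact this.symm

theorem mmap_id (t : M.obj X) : mmap M (fun x : X => x) t = t :=
  ConcreteCategory.congr_hom (M.map_id X) t

theorem mmap_munit (f : X → Y) (x : X) : mmap M f (munit M x) = munit M (f x) :=
  (ConcreteCategory.congr_hom (M.η.naturality (↾f)) x).symm

theorem mmap_mmul (f : X → Y) (t : M.obj (M.obj X)) :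
    mmap M f (mmul M t) = mmul M (mmap M (mmap M f) t) :=
  (ConcreteCategory.congr_hom (M.μ.naturality (↾f)) t).symm

theorem mmul_munit (t : M.obj X) : mmul M (munit M t) = t :=
  ConcreteCategory.congr_hom (M.left_unit X) t

end MonadLemmas

/-- The square with top `p : P → X`, left `q : P → Y`, right `f : X → Z`, bottom `g : Y → Z` is a
weak pullback of sets: it commutes, and the comparison to the fibre product is surjective. -/
def IsWeakPullbackSquare {P X Y Z : Type u} (p : P → X) (q : P → Y) (f : X → Z) (g : Y → Z) :
    Prop :=
  (∀ w, f (p w) = g (q w)) ∧ ∀ x y, f x = g y → ∃ w, p w = x ∧ q w = y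

/-- A strict topological theory with quantale `V`: a monad `T` on sets and a map `ξ : T V → V`. -/
structure StrictTopologicalTheory (V : Type u) [CommMonoid V] [CompleteLattice V]
    [IsQuantale V] where
  monad : Monad (Type u)
  ξ : monad.obj V → V
  /-- `T` sends pullbacks to weak pullbacks. -/
  weakPullback_map : ∀ {P X Y Z : Type u} (p : P ⟶ X) (q : P ⟶ Y) (f : X ⟶ Z) (g : Y ⟶ Z),
    IsPullback p q f g →
      IsWeakPullbackSquare (mmap monad p) (mmap monad q) (mmap monad f) (mmap monad g)
  /-- The naturality squares of the multiplication are weak pullbacks. -/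
  weakPullback_mul : ∀ {X Y : Type u} (f : X → Y),
    IsWeakPullbackSquare (mmap monad (mmap monad f)) (mmul monad) (mmul monad) (mmap monad f)
  /-- `(V, ξ)` is an Eilenberg--Moore algebra. -/
  ξ_unit : ∀ v, ξ (munit monad v) = v
  ξ_mul : ∀ t, ξ (mmul monad t) = ξ (mmap monad ξ t)
  /-- The tensor `V × V → V` is a homomorphism of algebras. -/
  ξ_tensor : ∀ w : monad.obj (V × V),
    ξ (mmap monad (fun p : V × V => p.1 * p.2) w) =
      ξ (mmap monad Prod.fst w) * ξ (mmap monad Prod.snd w)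
  /-- The unit `1 → V` is a homomorphism of algebras. -/
  ξ_one : ∀ t : monad.obj PUnit.{u + 1}, ξ (mmap monad (fun _ => (1 : V)) t) = 1
  /-- The maps `V ^ X → V ^ (T X)`, `φ ↦ ξ ∘ T φ`, are order-preserving and natural with respect
  to the direct images `f ↦ (φ ↦ (y ↦ ⨆ x ∈ f⁻¹ y, φ x))`. -/
  ξ_mono : ∀ {X : Type u} (φ ψ : X → V), φ ≤ ψ → ∀ t, ξ (mmap monad φ t) ≤ ξ (mmap monad ψ t)
  ξ_natural : ∀ {X Y : Type u} (f : X → Y) (φ : X → V) (t : monad.obj Y),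
    ξ (mmap monad (fun y => ⨆ x : {x // f x = y}, φ x.1) t) =
      ⨆ s : {s // mmap monad f s = t}, ξ (mmap monad φ s.1)

section Theory

variable {V : Type u} [CommMonoid V] [CompleteLattice V] [IsQuantale V]
variable (𝕋 : StrictTopologicalTheory V)

namespace StrictTopologicalTheory

/-- The functor part of the monad, on sets. -/
abbrev T (X : Type u) : Type u := 𝕋.monad.obj X

/-- The functor part of the monad, on functions. -/
abbrev map {X Y : Type u} (f : X → Y) : 𝕋.T X → 𝕋.T Y := mmap 𝕋.monad f

/-- The unit of the monad. -/
abbrev e {X : Type u} : X → 𝕋.T X := munit 𝕋.monad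

/-- The multiplication of the monad. -/
abbrev m {X : Type u} : 𝕋.T (𝕋.T X) → 𝕋.T X := mmul 𝕋.monad

section

variable {X Y Z : Type u}

theorem map_map (g : Y → Z) (f : X → Y) (t : 𝕋.T X) :
    𝕋.map g (𝕋.map f t) = 𝕋.map (fun x => g (f x)) t := mmap_comp _ g f t

theorem map_id (t : 𝕋.T X) : 𝕋.map (fun x : X => x) t = t := mmap_id _ t

theorem map_e (f : X → Y) (x : X) : 𝕋.map f (𝕋.e x) = 𝕋.e (f x) := mmap_munit _ f x

theorem map_m (f : X → Y) (t : 𝕋.T (𝕋.T X)) : 𝕋.map f (𝕋.m t) = 𝕋.m (𝕋.map (𝕋.map f) t) :=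
  mmap_mmul _ f t

theorem m_e (t : 𝕋.T X) : 𝕋.m (𝕋.e t) = t := mmul_munit _ t

theorem ξ_e (v : V) : 𝕋.ξ (𝕋.e v) = v := 𝕋.ξ_unit v

theorem ξ_m (t : 𝕋.T (𝕋.T V)) : 𝕋.ξ (𝕋.m t) = 𝕋.ξ (𝕋.map 𝕋.ξ t) := 𝕋.ξ_mul t

end

/-- The lax extension of `T` to `V`-matrices; `r y x` is the `(y, x)` entry of a matrix from `X`
to `Y`. -/
def ext {X Y : Type u} (r : Y → X → V) (𝔶 : 𝕋.T Y) (𝔵 : 𝕋.T X) : V :=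
  ⨆ w : {w : 𝕋.T (Y × X) // 𝕋.map Prod.fst w = 𝔶 ∧ 𝕋.map Prod.snd w = 𝔵},
    𝕋.ξ (𝕋.map (fun p : Y × X => r p.1 p.2) w.1)

theorem le_ext {X Y : Type u} (r : Y → X → V) (w : 𝕋.T (Y × X)) :
    𝕋.ξ (𝕋.map (fun p : Y × X => r p.1 p.2) w) ≤
      𝕋.ext r (𝕋.map Prod.fst w) (𝕋.map Prod.snd w) :=
  le_iSup (fun w' : {w' : 𝕋.T (Y × X) //
    𝕋.map Prod.fst w' = 𝕋.map Prod.fst w ∧ 𝕋.map Prod.snd w' = 𝕋.map Prod.snd w} =>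
    𝕋.ξ (𝕋.map (fun p : Y × X => r p.1 p.2) w'.1)) ⟨w, rfl, rfl⟩

theorem ξ_mul_map {X : Type u} (φ ψ : X → V) (t : 𝕋.T X) :
    𝕋.ξ (𝕋.map φ t) * 𝕋.ξ (𝕋.map ψ t) = 𝕋.ξ (𝕋.map (fun x => φ x * ψ x) t) := by
  have := 𝕋.ξ_tensor (𝕋.map (fun x => (φ x, ψ x)) t)
  simp only [𝕋.map_map] at this
  exact this.symm

theorem map_const [Subsingleton (𝕋.T PUnit.{u + 1})] {X Y : Type u} (y : Y) (t : 𝕋.T X) :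
    𝕋.map (fun _ => y) t = 𝕋.e y := by
  have h1 : 𝕋.map (fun _ => y) t =
      𝕋.map (fun _ : PUnit.{u + 1} => y) (𝕋.map (fun _ => PUnit.unit) t) := by
    simp only [𝕋.map_map]
  rw [h1, Subsingleton.elim (𝕋.map (fun _ => PUnit.unit) t) (𝕋.e PUnit.unit), 𝕋.map_e]

theorem mul_ξ_map [Subsingleton (𝕋.T PUnit.{u + 1})] {X : Type u} (v : V) (ψ : X → V)
    (t : 𝕋.T X) : v * 𝕋.ξ (𝕋.map ψ t) = 𝕋.ξ (𝕋.map (fun x => v * ψ x) t) := by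
  rw [← 𝕋.ξ_mul_map (fun _ => v) ψ, 𝕋.map_const, 𝕋.ξ_e]

/-- `T` weakly preserves the pullback of `Y × B → B` along `g : A → B`. -/
theorem exists_lift {Y A B : Type u} (g : A → B) (𝔮 : 𝕋.T (Y × B)) (𝔭 : 𝕋.T A)
    (h : 𝕋.map Prod.snd 𝔮 = 𝕋.map g 𝔭) :
    ∃ w : 𝕋.T (Y × A), 𝕋.map (fun p : Y × A => (p.1, g p.2)) w = 𝔮 ∧ 𝕋.map Prod.snd w = 𝔭 := by
  have hp : IsPullback (↾(fun p : Y × A => (p.1, g p.2))) (↾(Prod.snd : Y × A → A))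
      (↾(Prod.snd : Y × B → B)) (↾g) := by
    rw [Limits.Types.isPullback_iff]
    refine ⟨rfl, ?_, ?_⟩
    · rintro ⟨y, a⟩ ⟨y', a'⟩ ⟨h1, h2⟩
      simp only [TypeCat.ofHom_apply, Prod.mk.injEq] at h1 h2
      exact Prod.ext h1.1 h2
    · rintro ⟨y, b⟩ a h
      exact ⟨(y, a), Prod.ext rfl h.symm, rfl⟩
  exact (𝕋.weakPullback_map _ _ _ _ hp).2 𝔮 𝔭 h

end StrictTopologicalTheory

/-! ### `𝕋`-graphs and `𝕋`-categories -/

/-- A `𝕋`-graph; `str 𝔵 x` is the `(𝔵, x)` entry of the structure matrix from `X` to `T X`. -/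
structure TGraph where
  carrier : Type u
  str : 𝕋.T carrier → carrier → V
  refl : ∀ x, 1 ≤ str (𝕋.e x) x

variable {𝕋}

/-- `f` is a morphism of `𝕋`-graphs. -/
def IsGraphMorphism (A B : TGraph 𝕋) (f : A.carrier → B.carrier) : Prop :=
  ∀ 𝔵 x, A.str 𝔵 x ≤ B.str (𝕋.map f 𝔵) (f x)

variable (𝕋) in
/-- A `𝕋`-category: a `𝕋`-graph `(X, a)` with `m · (T_ξ a) · a ≤ a`. -/
structure TCat extends TGraph 𝕋 where
  trans : ∀ 𝔛 𝔵 x, 𝕋.ext str 𝔛 𝔵 * str 𝔵 x ≤ str (𝕋.m 𝔛) x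

namespace TCat

/-- A `𝕋`-functor. -/
@[ext]
structure Hom (X Y : TCat 𝕋) where
  toFun : X.carrier → Y.carrier
  isGraphMorphism : IsGraphMorphism X.toTGraph Y.toTGraph toFun

theorem isGraphMorphism_comp {A B C : TGraph 𝕋} {f : A.carrier → B.carrier}
    {g : B.carrier → C.carrier} (hf : IsGraphMorphism A B f) (hg : IsGraphMorphism B C g) :
    IsGraphMorphism A C (fun x => g (f x)) := fun 𝔵 x => by
  have := (hf 𝔵 x).trans (hg _ _)
  simpa only [𝕋.map_map] using this

instance : Category (TCat 𝕋) where
  Hom := Hom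
  id X := ⟨fun x => x, fun 𝔵 x => by simp only [𝕋.map_id]; exact le_rfl⟩
  comp f g := ⟨fun x => g.toFun (f.toFun x),
    isGraphMorphism_comp f.isGraphMorphism g.isGraphMorphism⟩

end TCat

/-- The `𝕋`-graph `(I, α°)` of an Eilenberg--Moore algebra `(I, α)`: its structure is `1` at
`(𝔦, i)` if `α 𝔦 = i`, and `⊥` otherwise. -/
def algebraGraph (I : 𝕋.monad.Algebra) : TGraph 𝕋 where
  carrier := I.A
  str 𝔦 i := ⨆ _ : I.a 𝔦 = i, 1
  refl i := le_iSup_of_le (ConcreteCategory.congr_hom I.unit i) le_rfl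

theorem isGraphMorphism_algebra_iff (I : 𝕋.monad.Algebra) (A : TGraph 𝕋) (t : I.A → A.carrier) :
    IsGraphMorphism (algebraGraph I) A t ↔ ∀ 𝔦, 1 ≤ A.str (𝕋.map t 𝔦) (t (I.a 𝔦)) := by
  constructor
  · intro h 𝔦
    exact le_trans (le_iSup_of_le (f := fun _ : I.a 𝔦 = I.a 𝔦 => (1 : V)) rfl le_rfl) (h 𝔦 _)
  · intro h 𝔦 i
    refine iSup_le fun hi => ?_
    subst hi
    exact h 𝔦

/-! ### The quantale as a `𝕋`-category -/

theorem ξ_ext_le {X : Type u} (a : 𝕋.T X → X → V) (g : 𝕋.T X → V) (f : X → V)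
    (h : ∀ 𝔵 x, a 𝔵 x * g 𝔵 ≤ f x) (𝔛 : 𝕋.T (𝕋.T X)) (𝔵 : 𝕋.T X) :
    𝕋.ext a 𝔛 𝔵 * 𝕋.ξ (𝕋.map g 𝔛) ≤ 𝕋.ξ (𝕋.map f 𝔵) := by
  unfold StrictTopologicalTheory.ext
  rw [Quantale.iSup_mul_distrib]
  refine iSup_le ?_
  rintro ⟨w, rfl, rfl⟩
  simp only [𝕋.map_map, 𝕋.ξ_mul_map]
  exact 𝕋.ξ_mono _ _ (fun p => h p.1 p.2) w

variable (𝕋) in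
/-- The quantale `V` as a `𝕋`-category, with structure `(𝔳, v) ↦ hom (ξ 𝔳) v`. -/
abbrev quantaleTCat : TCat 𝕋 where
  carrier := V
  str 𝔳 v := 𝕋.ξ 𝔳 ⇨ₗ v
  refl v := by rw [𝕋.ξ_e]; exact one_le_hom.2 le_rfl
  trans 𝔛 𝔵 x := by
    rw [le_hom_iff, 𝕋.ξ_m, mul_right_comm]
    have h := ξ_ext_le (fun (𝔳 : 𝕋.T V) v => 𝕋.ξ 𝔳 ⇨ₗ v) 𝕋.ξ (fun v => v)
      (fun 𝔳 v => hom_mul_le _ _) 𝔛 𝔵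
    rw [𝕋.map_id] at h
    exact (mul_le_mul_left h _).trans (by rw [mul_comm]; exact hom_mul_le _ _)

theorem isGraphMorphism_quantale_iff (X : TGraph 𝕋) (φ : X.carrier → V) :
    IsGraphMorphism X (quantaleTCat 𝕋).toTGraph φ ↔
      ∀ 𝔵 x, X.str 𝔵 x * 𝕋.ξ (𝕋.map φ 𝔵) ≤ φ x :=
  forall₂_congr fun _ _ => le_hom_iff

/-! ### `𝕋`-frames -/

/-- The underlying `V`-graph of the `𝕋`-graph `A` is a `V`-category (reflexivity is automatic). -/
def TGraph.IsVCat (A : TGraph 𝕋) : Prop :=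
  ∀ x y z, A.str (𝕋.e x) y * A.str (𝕋.e y) z ≤ A.str (𝕋.e x) z

/-- The underlying `V`-category of a `𝕋`-graph. -/
def TGraph.vcat (A : TGraph 𝕋) (hA : A.IsVCat) : VCat V A.carrier where
  hom x y := A.str (𝕋.e x) y
  refl := A.refl
  trans := hA

/-- A `𝕋`-weighted diagram in `A`: a `V`-functor `h : I → A` and a weight `ψ : 1 ⇸ I`, where `I` is
a set with both an algebra structure and a `V`-category structure `r`, such that
`i ↦ ψ i ⊗ h i` is a `𝕋`-graph morphism. -/
def IsTWeightedDiagram (A : TGraph 𝕋) (hA : A.IsVCat) (I : 𝕋.monad.Algebra) (r : VCat V I.A)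
    (h : I.A → A.carrier) (ψ : I.A → V) : Prop :=
  IsVFunctor r (A.vcat hA) h ∧ IsColimitWeight r ψ ∧
    ∃ t : I.A → A.carrier, (∀ i, IsTensor (A.vcat hA) (ψ i) (h i) (t i)) ∧
      IsGraphMorphism (algebraGraph I) A t

/-- A presheaf on `A` is `𝕋`-generated if it is the composite `h_* · ψ` for some `𝕋`-weighted
diagram `(h, ψ)`. -/
def IsTGenerated (A : TGraph 𝕋) (hA : A.IsVCat) (χ : Presheaf (A.vcat hA)) : Prop :=
  ∃ (I : 𝕋.monad.Algebra) (r : VCat V I.A) (h : I.A → A.carrier) (ψ : I.A → V),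
    IsTWeightedDiagram A hA I r h ψ ∧ ∀ x, χ.1 x = ⨆ i, (A.vcat hA).hom x (h i) * ψ i

variable (𝕋) in
/-- A `𝕋`-frame. Limits and suprema in `A` are unique only up to equivalence, so the law
`sup (lim (φ, h)) = lim (φ, sup ∘ h)` says that every supremum `c` of the presheaf `lim (φ, h)` is a
limit, weighted by `φ`, of any choice `s` of suprema of the presheaves `h i`. -/
structure TFrm extends TGraph 𝕋 where
  isVCat : toTGraph.IsVCat
  complete : IsComplete (toTGraph.vcat isVCat)
  distrib : ∀ (I : Type u) (r : VCat V I) (φ : I → V) (h : I → Presheaf (toTGraph.vcat isVCat)),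
    IsLimitWeight r φ → IsVFunctor r (presheafVCat (toTGraph.vcat isVCat)) h →
    (∀ i, IsTGenerated toTGraph isVCat (h i)) →
    ∀ l, IsWeightedLimit (presheafVCat (toTGraph.vcat isVCat)) φ h l →
      IsTGenerated toTGraph isVCat l →
      ∀ s : I → carrier, (∀ i, IsPresheafSup (toTGraph.vcat isVCat) (h i) (s i)) →
        ∀ c, IsPresheafSup (toTGraph.vcat isVCat) l c →
          IsWeightedLimit (toTGraph.vcat isVCat) φ s c

namespace TFrm

/-- The underlying `V`-category of a `𝕋`-frame. -/
abbrev V' (A : TFrm 𝕋) : VCat V A.carrier := A.toTGraph.vcat A.isVCat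

/-- A `𝕋`-frame homomorphism: a `𝕋`-compatible `V`-functor that preserves weighted limits and
`𝕋`-weighted colimits. -/
@[ext]
structure Hom (A B : TFrm 𝕋) where
  toFun : A.carrier → B.carrier
  isVFunctor : IsVFunctor A.V' B.V' toFun
  compatible : ∀ (I : 𝕋.monad.Algebra) (h : I.A → A.carrier),
    IsGraphMorphism (algebraGraph I) A.toTGraph h →
      IsGraphMorphism (algebraGraph I) B.toTGraph (fun i => toFun (h i))
  map_limit : ∀ (I : Type u) (r : VCat V I) (φ : I → V) (h : I → A.carrier),
    IsLimitWeight r φ → IsVFunctor r A.V' h →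
    ∀ l, IsWeightedLimit A.V' φ h l → IsWeightedLimit B.V' φ (fun i => toFun (h i)) (toFun l)
  map_colimit : ∀ (I : 𝕋.monad.Algebra) (r : VCat V I.A) (h : I.A → A.carrier) (ψ : I.A → V),
    IsTWeightedDiagram A.toTGraph A.isVCat I r h ψ →
    ∀ c, IsWeightedColimit A.V' ψ h c → IsWeightedColimit B.V' ψ (fun i => toFun (h i)) (toFun c)

section Cat

variable [Subsingleton (𝕋.T PUnit.{u + 1})]

/-- The one-point algebra. -/
def pointAlgebra (𝕋 : StrictTopologicalTheory V) [Subsingleton (𝕋.T PUnit.{u + 1})] :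
    𝕋.monad.Algebra where
  A := PUnit.{u + 1}
  a := ↾(fun _ => PUnit.unit)
  unit := rfl
  assoc := rfl

variable (V) in
/-- The one-point `V`-category. -/
def pointVCat : VCat V PUnit.{u + 1} where
  hom _ _ := 1
  refl _ := le_rfl
  trans _ _ _ := by simp

theorem Hom.map_tensor {A B : TFrm 𝕋} (f : Hom A B) {v : V} {x t : A.carrier}
    (ht : IsTensor A.V' v x t) : IsTensor B.V' v (f.toFun x) (f.toFun t) := by
  have h := f.map_colimit (pointAlgebra 𝕋) (pointVCat V) (fun _ => x) (fun _ => v)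
    ⟨fun _ _ => A.V'.refl x, fun _ _ => (one_mul v).le, fun _ => t, fun _ => ht,
      (isGraphMorphism_algebra_iff _ _ _).2 fun 𝔦 => by
        rw [𝕋.map_const]; exact A.refl t⟩ t
    (fun a => by rw [ht a]; exact (iInf_const (ι := PUnit.{u + 1})).symm)
  intro b
  rw [h b]
  exact iInf_const (ι := PUnit.{u + 1})

theorem Hom.map_diagram {A B : TFrm 𝕋} (f : Hom A B) {I : 𝕋.monad.Algebra} {r : VCat V I.A}
    {h : I.A → A.carrier} {ψ : I.A → V} (hd : IsTWeightedDiagram A.toTGraph A.isVCat I r h ψ) :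
    IsTWeightedDiagram B.toTGraph B.isVCat I r (fun i => f.toFun (h i)) ψ := by
  obtain ⟨h1, h2, t, h3, h4⟩ := hd
  exact ⟨fun x y => (h1 x y).trans (f.isVFunctor _ _), h2, fun i => f.toFun (t i),
    fun i => f.map_tensor (h3 i), f.compatible I t h4⟩

instance : Category (TFrm 𝕋) where
  Hom := Hom
  id A :=
    { toFun := fun x => x
      isVFunctor := fun _ _ => le_rfl
      compatible := fun _ _ h => h
      map_limit := fun _ _ _ _ _ _ _ h => h
      map_colimit := fun _ _ _ _ _ _ h => h }
  comp f g :=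
    { toFun := fun x => g.toFun (f.toFun x)
      isVFunctor := fun x y => (f.isVFunctor x y).trans (g.isVFunctor _ _)
      compatible := fun I h hh => g.compatible I _ (f.compatible I h hh)
      map_limit := fun I r φ h hφ hh l hl => g.map_limit I r φ _ hφ
        (fun x y => (hh x y).trans (f.isVFunctor _ _)) _ (f.map_limit I r φ h hφ hh l hl)
      map_colimit := fun I r h ψ hd c hc => g.map_colimit I r _ ψ (f.map_diagram hd) _
        (f.map_colimit I r h ψ hd c hc) }

end Cat

end TFrm

/-! ### `𝕋`-graphs of `V`-valued functions

Both `V ^ X` and `V` are `𝕋`-graphs whose elements are (certain) functions to `V`; the following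
facts treat them at once. -/

/-- `ev` presents the elements of the `𝕋`-graph `A` as `V`-valued functions on `S`, with the
pointwise `V`-category structure, such that the evaluations are representable and pointwise
weighted limits and pointwise `𝕋`-weighted colimits stay in `A`. -/
structure PointwisePresentation (A : TGraph 𝕋) (S : Type u) where
  ev : S → A.carrier → V
  y : S → A.carrier
  str_eq : ∀ a b, A.str (𝕋.e a) b = ⨅ x, ev x a ⇨ₗ ev x b
  inj : ∀ a b, (∀ x, ev x a = ev x b) → a = b
  str_y : ∀ x a, A.str (𝕋.e (y x)) a = ev x a
  exists_tensor : ∀ v a, ∃ t, ∀ x, ev x t = v * ev x a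
  exists_limit : ∀ (I : Type u) (φ : I → V) (h : I → A.carrier),
    ∃ l, ∀ x, ev x l = ⨅ i, φ i ⇨ₗ ev x (h i)
  exists_sup : ∀ (I : 𝕋.monad.Algebra) (t : I.A → A.carrier),
    IsGraphMorphism (algebraGraph I) A t → ∃ c, ∀ x, ev x c = ⨆ i, ev x (t i)

namespace PointwisePresentation

variable {A : TGraph 𝕋} {S : Type u}

theorem isVCat (P : PointwisePresentation A S) : A.IsVCat := fun a b c => by
  simp only [P.str_eq]
  exact le_iInf fun x => (mul_le_mul' (iInf_le _ x) (iInf_le _ x)).trans (hom_comp _ _ _)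

theorem eq_of_forall (P : PointwisePresentation A S) (a b : A.carrier) (h : ∀ c, A.str (𝕋.e a) c = A.str (𝕋.e b) c) : a = b := by
  refine P.inj a b fun x => le_antisymm ?_ ?_
  · have h1 := (A.refl b).trans (h b).symm.le
    rw [P.str_eq] at h1
    exact one_le_hom.1 (h1.trans (iInf_le _ x))
  · have h1 := (A.refl a).trans (h a).le
    rw [P.str_eq] at h1
    exact one_le_hom.1 (h1.trans (iInf_le _ x))

variable (P : PointwisePresentation A S) (hA : A.IsVCat)

theorem isLimit_iff {I : Type u} (φ : I → V) (h : I → A.carrier) (l : A.carrier) :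
    IsWeightedLimit (A.vcat hA) φ h l ↔ ∀ x, P.ev x l = ⨅ i, φ i ⇨ₗ P.ev x (h i) := by
  constructor
  · intro hl x
    have := hl (P.y x)
    simpa only [TGraph.vcat, P.str_y] using this
  · intro hl a
    simp only [TGraph.vcat, P.str_eq, hl, hom_iInf]
    rw [iInf_comm]
    exact iInf_congr fun i => iInf_congr fun x => hom_swap _ _ _

theorem isTensor_iff (v : V) (a t : A.carrier) :
    IsTensor (A.vcat hA) v a t ↔ ∀ x, P.ev x t = v * P.ev x a := by
  have key : ∀ t', (∀ x, P.ev x t' = v * P.ev x a) → IsTensor (A.vcat hA) v a t' := by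
    intro t' ht b
    simp only [TGraph.vcat, P.str_eq, ht, hom_iInf, hom_curry]
  refine ⟨fun ht => ?_, key t⟩
  obtain ⟨t', ht'⟩ := P.exists_tensor v a
  have : t = t' := P.eq_of_forall _ _ fun c => (ht c).trans (key t' ht' c).symm
  exact this ▸ ht'

theorem isColimit_iff (I : 𝕋.monad.Algebra) (r : VCat V I.A) (h : I.A → A.carrier) (ψ : I.A → V)
    (hd : IsTWeightedDiagram A hA I r h ψ) (c : A.carrier) :
    IsWeightedColimit (A.vcat hA) ψ h c ↔ ∀ x, P.ev x c = ⨆ i, ψ i * P.ev x (h i) := by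
  have key : ∀ c', (∀ x, P.ev x c' = ⨆ i, ψ i * P.ev x (h i)) →
      IsWeightedColimit (A.vcat hA) ψ h c' := by
    intro c' hc b
    simp only [TGraph.vcat, P.str_eq, hc, hom_iInf, iSup_hom, hom_curry]
    rw [iInf_comm]
  refine ⟨fun hc => ?_, key c⟩
  obtain ⟨-, -, t, ht, hg⟩ := hd
  obtain ⟨c', hc'⟩ := P.exists_sup I t hg
  have hc'' : ∀ x, P.ev x c' = ⨆ i, ψ i * P.ev x (h i) := fun x =>
    (hc' x).trans (iSup_congr fun i => (P.isTensor_iff hA _ _ _).1 (ht i) x)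
  have : c = c' := P.eq_of_forall _ _ fun b => (hc b).trans (key c' hc'' b).symm
  exact this ▸ hc''

theorem ev_presheafSup (χ : Presheaf (A.vcat hA)) (hχ : IsTGenerated A hA χ) (c : A.carrier)
    (hc : IsPresheafSup (A.vcat hA) χ c) (x : S) : P.ev x c = χ.1 (P.y x) := by
  obtain ⟨I, r, h, ψ, hd, hχ⟩ := hχ
  have hcol : IsWeightedColimit (A.vcat hA) ψ h c := by
    intro a
    rw [hc a]
    refine le_antisymm (le_iInf fun i => ?_) (le_iInf fun b => ?_)
    · refine (iInf_le _ (h i)).trans (hom_mono ?_ le_rfl)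
      rw [hχ]
      refine le_trans ?_ (le_iSup _ i)
      calc ψ i = 1 * ψ i := (one_mul _).symm
        _ ≤ _ := mul_le_mul_left ((A.vcat hA).refl (h i)) _
    · rw [hχ, iSup_hom]
      refine le_iInf fun i => (iInf_le _ i).trans ?_
      rw [mul_comm, hom_curry]
      refine hom_mono le_rfl (le_hom_iff.2 ?_)
      rw [mul_comm]
      exact (A.vcat hA).trans _ _ _
  rw [(P.isColimit_iff hA I r h ψ hd c).1 hcol x, hχ]
  refine iSup_congr fun i => ?_
  rw [mul_comm]
  exact congrArg (· * ψ i) (P.str_y x (h i)).symm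

/-- A `𝕋`-graph with a pointwise presentation is a `𝕋`-frame. -/
abbrev toTFrm : TFrm 𝕋 where
  toTGraph := A
  isVCat := P.isVCat
  complete := fun I r φ h _ _ => by
    obtain ⟨l, hl⟩ := P.exists_limit I φ h
    exact ⟨l, (P.isLimit_iff _ φ h l).2 hl⟩
  distrib := fun I r φ h hφ hh hg l hl hlg s hs c hc => by
    rw [P.isLimit_iff]
    intro x
    rw [P.ev_presheafSup _ l hlg c hc]
    have hs' : ∀ i, P.ev x (s i) = (h i).1 (P.y x) := fun i =>
      P.ev_presheafSup _ (h i) (hg i) (s i) (hs i) x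
    simp only [hs']
    -- limits of presheaves are pointwise
    let l' : Presheaf (A.vcat P.isVCat) := ⟨fun a => ⨅ i, φ i ⇨ₗ (h i).1 a, fun a b =>
      le_iInf fun i => le_hom_iff.2 <| by
        calc (A.vcat P.isVCat).hom a b * (⨅ i, φ i ⇨ₗ (h i).1 b) * φ i
            ≤ (A.vcat P.isVCat).hom a b * ((φ i ⇨ₗ (h i).1 b) * φ i) := by
              rw [mul_assoc]
              exact mul_le_mul_right (mul_le_mul_left (iInf_le _ i) _) _
          _ ≤ (A.vcat P.isVCat).hom a b * (h i).1 b := mul_le_mul_right (hom_mul_le _ _) _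
          _ ≤ (h i).1 a := (h i).2 a b⟩
    have hl' : ∀ χ, (presheafVCat (A.vcat P.isVCat)).hom χ l' =
        (presheafVCat (A.vcat P.isVCat)).hom χ l := by
      intro χ
      rw [hl χ]
      simp only [presheafVCat, hom_iInf, l']
      rw [iInf_comm]
      exact iInf_congr fun i => iInf_congr fun x => hom_swap _ _ _
    have e1 : l.1 (P.y x) ≤ l'.1 (P.y x) := one_le_hom.1 <|
      (((presheafVCat (A.vcat P.isVCat)).refl l).trans (hl' l).symm.le).trans (iInf_le _ _)
    have e2 : l'.1 (P.y x) ≤ l.1 (P.y x) := one_le_hom.1 <|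
      (((presheafVCat (A.vcat P.isVCat)).refl l').trans (hl' l').le).trans (iInf_le _ _)
    exact le_antisymm e1 e2

end PointwisePresentation

/-- `V` is pointwise presented by functions on one point. -/
def quantalePresentation (𝕋 : StrictTopologicalTheory V) :
    PointwisePresentation (quantaleTCat 𝕋).toTGraph PUnit.{u + 1} where
  ev _ v := v
  y _ := (1 : V)
  str_eq a b := by
    rw [iInf_const]
    exact congrArg (· ⇨ₗ b) (𝕋.ξ_e a)
  inj a b h := h PUnit.unit
  str_y _ a := (congrArg (· ⇨ₗ a) (𝕋.ξ_e 1)).trans (one_hom a)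
  exists_tensor v a := ⟨(v * a : V), fun _ => rfl⟩
  exists_limit I φ h := ⟨(⨅ i, φ i ⇨ₗ h i : V), fun _ => rfl⟩
  exists_sup I t _ := ⟨(⨆ i, t i : V), fun _ => rfl⟩

variable (𝕋) in
/-- The quantale `V` as a `𝕋`-frame; its `𝕋`-graph is that of the `𝕋`-category `V`. -/
abbrev quantaleTFrm : TFrm 𝕋 := (quantalePresentation 𝕋).toTFrm

/-! ### The functor `Ω` -/

/-- The set of `𝕋`-functors from `X` to `V`. -/
abbrev VFun (X : TCat 𝕋) : Type u := X ⟶ quantaleTCat 𝕋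

theorem VFun.le {X : TCat 𝕋} (φ : VFun X) (𝔵 : 𝕋.T X.carrier) (x : X.carrier) :
    X.str 𝔵 x * 𝕋.ξ (𝕋.map φ.toFun 𝔵) ≤ φ.toFun x :=
  (isGraphMorphism_quantale_iff _ _).1 φ.isGraphMorphism 𝔵 x

/-- The structure matrix of the function space `V ^ X`: the infimum of
`hom (a (T π₁ 𝔮) x) (hom (ξ (T ev 𝔮)) (φ x))` over all `x` and all `𝔮 ∈ T (X × V ^ X)` that
project to `𝔭`. -/
def functionSpaceStr (X : TCat 𝕋) (𝔭 : 𝕋.T (VFun X)) (φ : VFun X) : V :=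
  ⨅ (𝔮 : {𝔮 : 𝕋.T (X.carrier × VFun X) // 𝕋.map Prod.snd 𝔮 = 𝔭}) (x : X.carrier),
    X.str (𝕋.map Prod.fst 𝔮.1) x ⇨ₗ
      (𝕋.ξ (𝕋.map (fun p : X.carrier × VFun X => (p.2.toFun p.1 : V)) 𝔮.1) ⇨ₗ
        (φ.toFun x : V))

theorem functionSpaceStr_unit (X : TCat 𝕋) (φ φ' : VFun X) :
    functionSpaceStr X (𝕋.e φ) φ' = ⨅ x, (φ.toFun x : V) ⇨ₗ (φ'.toFun x : V) := by
  refine le_antisymm (le_iInf fun x => ?_) (le_iInf fun 𝔮 => le_iInf fun x => ?_)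
  · refine (iInf_le _ ⟨𝕋.e (x, φ), 𝕋.map_e _ _⟩).trans ((iInf_le _ x).trans ?_)
    simp only [𝕋.map_e, 𝕋.ξ_e]
    calc _ ≤ (1 : V) ⇨ₗ _ := hom_mono (X.refl x) le_rfl
      _ = _ := one_hom _
  · obtain ⟨𝔮, h𝔮⟩ := 𝔮
    obtain ⟨w, rfl, -⟩ := 𝕋.exists_lift (fun _ : PUnit.{u + 1} => φ) 𝔮 (𝕋.e PUnit.unit)
      (by rw [𝕋.map_e]; exact h𝔮)
    refine (iInf_le _ x).trans ?_
    simp only [𝕋.map_map]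
    rw [← hom_curry]
    refine hom_mono ?_ le_rfl
    have := φ.le (𝕋.map Prod.fst w) x
    simpa only [𝕋.map_map] using this

/-- The `𝕋`-graph `V ^ X` of `𝕋`-functors from `X` to `V`. -/
abbrev functionSpace (X : TCat 𝕋) : TGraph 𝕋 where
  carrier := VFun X
  str := functionSpaceStr X
  refl φ := by
    rw [functionSpaceStr_unit]
    exact le_iInf fun x => one_le_hom.2 le_rfl

theorem functionSpaceStr_le {X : TCat 𝕋} (𝔮 : 𝕋.T (X.carrier × VFun X)) (φ : VFun X)
    (x : X.carrier) :
    functionSpaceStr X (𝕋.map Prod.snd 𝔮) φ * (X.str (𝕋.map Prod.fst 𝔮) x *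
      𝕋.ξ (𝕋.map (fun p : X.carrier × VFun X => (p.2.toFun p.1 : V)) 𝔮)) ≤ φ.toFun x := by
  rw [← le_hom_iff, hom_curry]
  exact (iInf_le _ ⟨𝔮, rfl⟩).trans (iInf_le _ x)

theorem precomp_isGraphMorphism {X Y : TCat 𝕋} (f : X ⟶ Y) :
    IsGraphMorphism (functionSpace Y) (functionSpace X) (fun φ : VFun Y => f ≫ φ) := by
  intro 𝔭 φ
  refine le_iInf fun 𝔮 => le_iInf fun x => ?_
  obtain ⟨𝔮, h𝔮⟩ := 𝔮
  obtain ⟨w, rfl, rfl⟩ := 𝕋.exists_lift (fun φ : VFun Y => f ≫ φ) 𝔮 𝔭 h𝔮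
  have h := functionSpaceStr_le (𝕋.map (fun p : X.carrier × VFun Y => (f.toFun p.1, p.2)) w) φ
    (f.toFun x)
  simp only [𝕋.map_map] at h ⊢
  rw [← hom_curry, le_hom_iff]
  refine le_trans (mul_le_mul_right (mul_le_mul_left ?_ _) _) h
  have := f.isGraphMorphism (𝕋.map Prod.fst w) x
  simpa only [𝕋.map_map] using this

section Functors

variable [Subsingleton (𝕋.T PUnit.{u + 1})]

/-- `V ^ X` is pointwise presented by functions on `X`. -/
def functionSpacePresentation (X : TCat 𝕋) :
    PointwisePresentation (functionSpace X) X.carrier where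
  ev x φ := φ.toFun x
  y x := ⟨fun x' => X.str (𝕋.e x) x', (isGraphMorphism_quantale_iff _ _).2 fun 𝔵 x' => by
    have h1 : 𝕋.ξ (𝕋.map (fun x' => X.str (𝕋.e x) x') 𝔵) ≤ 𝕋.ext X.str (𝕋.e (𝕋.e x)) 𝔵 := by
      have := 𝕋.le_ext X.str (𝕋.map (fun z => (𝕋.e x, z)) 𝔵)
      simpa only [𝕋.map_map, 𝕋.map_const, 𝕋.map_id] using this
    have h2 := X.trans (𝕋.e (𝕋.e x)) 𝔵 x'
    rw [𝕋.m_e] at h2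
    rw [mul_comm]
    exact (mul_le_mul_left h1 _).trans h2⟩
  str_eq φ φ' := functionSpaceStr_unit X φ φ'
  inj φ φ' h := TCat.Hom.ext (funext h)
  str_y x φ := by
    refine (functionSpaceStr_unit X _ φ).trans (le_antisymm ?_ (le_iInf fun x' => ?_))
    · refine (iInf_le _ x).trans ?_
      calc _ ≤ (1 : V) ⇨ₗ _ := hom_mono (X.refl x) le_rfl
        _ = _ := one_hom _
    · rw [le_hom_iff]
      have := φ.le (𝕋.e x) x'
      rw [𝕋.map_e, 𝕋.ξ_e] at this
      rwa [mul_comm]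
  exists_tensor v φ := ⟨⟨fun x => (v * φ.toFun x : V),
    (isGraphMorphism_quantale_iff _ _).2 fun 𝔵 x => by
      rw [← 𝕋.mul_ξ_map, mul_left_comm]
      exact mul_le_mul_right (φ.le 𝔵 x) _⟩, fun _ => rfl⟩
  exists_limit I φ h := ⟨⟨fun x => (⨅ i, φ i ⇨ₗ (h i).toFun x : V),
    (isGraphMorphism_quantale_iff _ _).2 fun 𝔵 x => le_iInf fun i => by
      rw [le_hom_iff, mul_assoc, mul_comm _ (φ i), 𝕋.mul_ξ_map]
      refine (mul_le_mul_right (𝕋.ξ_mono _ _ (fun x' => ?_) 𝔵) _).trans ((h i).le 𝔵 x)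
      rw [mul_comm]
      exact (mul_le_mul_left (iInf_le _ i) _).trans (hom_mul_le _ _)⟩, fun _ => rfl⟩
  exists_sup I t ht := ⟨⟨fun x => (⨆ i, (t i).toFun x : V),
    (isGraphMorphism_quantale_iff _ _).2 fun 𝔵 x => by
      have hsup : (fun x => (⨆ i, (t i).toFun x : V)) = fun x =>
          ⨆ p : {p : X.carrier × I.A // p.1 = x}, ((t p.1.2).toFun p.1.1 : V) := by
        funext x
        refine le_antisymm (iSup_le fun i => ?_) (iSup_le ?_)
        · exact le_iSup (fun p : {p : X.carrier × I.A // p.1 = x} =>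
            ((t p.1.2).toFun p.1.1 : V)) ⟨(x, i), rfl⟩
        · rintro ⟨⟨x', i⟩, rfl⟩
          exact le_iSup (fun i => ((t i).toFun x' : V)) i
      have hnat := 𝕋.ξ_natural (Prod.fst : X.carrier × I.A → X.carrier)
        (fun p => ((t p.2).toFun p.1 : V)) 𝔵
      rw [← hsup] at hnat
      refine (congrArg (X.str 𝔵 x * ·) hnat).le.trans ?_
      rw [Quantale.mul_iSup_distrib]
      refine iSup_le ?_
      rintro ⟨w, rfl⟩
      refine le_trans ?_ (le_iSup (fun i => ((t i).toFun x : V)) (I.a (𝕋.map Prod.snd w)))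
      have h1 := (isGraphMorphism_algebra_iff _ _ _).1 ht (𝕋.map Prod.snd w)
      have h2 := functionSpaceStr_le (𝕋.map (fun p : X.carrier × I.A => (p.1, t p.2)) w)
        (t (I.a (𝕋.map Prod.snd w))) x
      simp only [𝕋.map_map] at h1 h2
      refine le_trans ?_ h2
      calc _ = 1 * _ := (one_mul _).symm
        _ ≤ _ := mul_le_mul_left h1 _⟩, fun _ => rfl⟩

/-- The `𝕋`-frame `Ω X`, whose `𝕋`-graph is `V ^ X`. -/
abbrev OmegaObj (X : TCat 𝕋) : TFrm 𝕋 := (functionSpacePresentation X).toTFrm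

/-- The `𝕋`-frame homomorphism `Ω f : φ ↦ φ ∘ f`. -/
def OmegaMap {X Y : TCat 𝕋} (f : X ⟶ Y) : OmegaObj Y ⟶ OmegaObj X :=
  TFrm.Hom.mk (A := OmegaObj Y) (B := OmegaObj X)
    (fun φ : VFun Y => (f ≫ φ : VFun X))
    (fun φ φ' => by
      refine (functionSpaceStr_unit Y φ φ').le.trans (le_trans ?_
        (functionSpaceStr_unit X (f ≫ φ) (f ≫ φ')).ge)
      exact le_iInf fun x => iInf_le _ (f.toFun x))
    (fun I h hh => TCat.isGraphMorphism_comp hh (precomp_isGraphMorphism f))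
    (fun I r φ h _ _ l hl => by
      have := ((functionSpacePresentation Y).isLimit_iff _ φ h l).1 hl
      exact ((functionSpacePresentation X).isLimit_iff _ φ _ _).2 fun x => this (f.toFun x))
    (fun I r h ψ hd c hc => by
      have h1 := ((functionSpacePresentation Y).isColimit_iff _ I r h ψ hd c).1 hc
      obtain ⟨hd1, hd2, t, ht, hg⟩ := hd
      refine ((functionSpacePresentation X).isColimit_iff _ I r _ ψ
        ⟨?_, hd2, fun i => f ≫ t i, fun i => ?_, ?_⟩ _).2 fun x => h1 (f.toFun x)
      · intro i j
        refine (hd1 i j).trans ((functionSpaceStr_unit Y (h i) (h j)).le.trans (le_trans ?_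
          (functionSpaceStr_unit X (f ≫ h i) (f ≫ h j)).ge))
        exact le_iInf fun x => iInf_le _ (f.toFun x)
      · have := ((functionSpacePresentation Y).isTensor_iff _ _ _ _).1 (ht i)
        exact ((functionSpacePresentation X).isTensor_iff _ _ _ _).2 fun x => this (f.toFun x)
      · exact TCat.isGraphMorphism_comp hg (precomp_isGraphMorphism f))

variable (𝕋) in
/-- The functor `Ω`, contravariantly represented by `V`. -/
def Omega : (TCat 𝕋)ᵒᵖ ⥤ TFrm 𝕋 where
  obj X := OmegaObj X.unop
  map f := OmegaMap f.unop

/-! ### The functor `pt` -/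

/-- The `𝕋`-category of points of `A`: the set of `𝕋`-frame homomorphisms from `A` to `V`, with the
largest `𝕋`-category structure that makes all evaluation maps `h ↦ h x` into `𝕋`-functors to `V`
(see `le_ptStr`). -/
abbrev ptObj (A : TFrm 𝕋) : TCat 𝕋 where
  carrier := A ⟶ quantaleTFrm 𝕋
  str 𝔭 h := ⨅ x : A.carrier,
    𝕋.ξ (𝕋.map (fun g : A ⟶ quantaleTFrm 𝕋 => (g.toFun x : V)) 𝔭) ⇨ₗ (h.toFun x : V)
  refl h := le_iInf fun x => by
    rw [𝕋.map_e, 𝕋.ξ_e]; exact one_le_hom.2 le_rfl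
  trans 𝔓 𝔭 h := le_iInf fun x => by
    rw [le_hom_iff, 𝕋.map_m, 𝕋.ξ_m, 𝕋.map_map, mul_right_comm]
    have h1 := ξ_ext_le (fun 𝔭 (h : A ⟶ quantaleTFrm 𝕋) => ⨅ x : A.carrier,
        𝕋.ξ (𝕋.map (fun g : A ⟶ quantaleTFrm 𝕋 => (g.toFun x : V)) 𝔭) ⇨ₗ (h.toFun x : V))
      (fun 𝔭 => 𝕋.ξ (𝕋.map (fun g : A ⟶ quantaleTFrm 𝕋 => (g.toFun x : V)) 𝔭))
      (fun g => (g.toFun x : V))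
      (fun 𝔭 h => (mul_le_mul_left (iInf_le _ x) _).trans (hom_mul_le _ _)) 𝔓 𝔭
    refine (mul_le_mul_left h1 _).trans ?_
    rw [mul_comm]
    exact (mul_le_mul_left (iInf_le _ x) _).trans (hom_mul_le _ _)

theorem ev_isGraphMorphism (A : TFrm 𝕋) (x : A.carrier) :
    IsGraphMorphism (ptObj A).toTGraph (quantaleTCat 𝕋).toTGraph
      (fun h : A ⟶ quantaleTFrm 𝕋 => h.toFun x) :=
  fun _ _ => iInf_le _ x

theorem le_ptStr (A : TFrm 𝕋) (B : TCat 𝕋) (f : B.carrier → (ptObj A).carrier)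
    (h : ∀ x : A.carrier, IsGraphMorphism B.toTGraph (quantaleTCat 𝕋).toTGraph
      (fun b => (f b : A ⟶ quantaleTFrm 𝕋).toFun x)) :
    IsGraphMorphism B.toTGraph (ptObj A).toTGraph f := fun 𝔟 b => le_iInf fun x => by
  have := h x 𝔟 b
  simp only [𝕋.map_map]
  exact this

variable (𝕋) in
/-- The functor `pt`, contravariantly represented by `V`. -/
def pt : (TFrm 𝕋)ᵒᵖ ⥤ TCat 𝕋 where
  obj A := ptObj A.unop
  map {A B} f := TCat.Hom.mk (X := ptObj A.unop) (Y := ptObj B.unop)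
    (fun h : A.unop ⟶ quantaleTFrm 𝕋 => (f.unop ≫ h : B.unop ⟶ quantaleTFrm 𝕋))
    (le_ptStr _ _ _ fun x => ev_isGraphMorphism A.unop (f.unop.toFun x))

end Functors

end Theory

end TFrames

open TFrames

namespace TFrames

section Evaluation

variable {V : Type u} [CommMonoid V] [CompleteLattice V] [IsQuantale V]
variable {𝕋 : StrictTopologicalTheory V} [Subsingleton (𝕋.T PUnit.{u + 1})]

/-! The quantale `V` plays two roles, as a `𝕋`-category and as a `𝕋`-frame. Both `Ω` and `pt` are
given by maps into `V`, so the unit has to be evaluation. What needs proof is that evaluating at a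
fixed point `x` respects the frame structure of `V ^ X`, and that the evaluation depends
`𝕋`-functorially on `x`.

The first part holds because the relevant structure of `V ^ X` is pointwise, as recorded in
`functionSpacePresentation`. Weighted limits are pointwise because the evaluations are
representable. Colimits of `𝕋`-weighted diagrams are pointwise for a different reason: the pointwise
supremum of the tensors `ψ i ⊗ h i` is again a `𝕋`-functor, and colimits are unique because
equivalent elements of `V ^ X` are equal. By `quantalePresentation`, `V` is described in the same
way by functions on one point. Preservation by evaluation therefore amounts to reading a formula
valid for all points at the single point `x`.

Compatibility with algebras is the one condition that involves the full `𝕋`-graph structure. It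
follows from the stronger fact `evalAt_isGraphMorphism`, where the function space structure is
tested on the image of `𝔭` under `φ ↦ (x, φ)`. Here `T 1 = 1` is essential: it forces the first
projection of that image to be `e x`, and reflexivity of `X` applies there.

The second part is the universal property `le_ptStr`: the structure of `pt (Ω X)` is the largest one
making the evaluations at all `φ` into `𝕋`-functors, and the composite of `x ↦ ev_x` with evaluation
at `φ` is `φ` itself. -/

/-- Evaluation at `x` is a `V`-functor `V ^ X → V`. -/
theorem evalAt_isVFunctor (X : TCat 𝕋) (x : X.carrier) :
    IsVFunctor (OmegaObj X).V' (quantaleTFrm 𝕋).V' (fun φ : VFun X => (φ.toFun x : V)) :=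
  -- The hom of `V ^ X` is an infimum over all points, and only the component at `x` is kept. On the
  -- side of `V` the hom is `ξ (e v) ⇨ₗ w`, which the unit law of `ξ` reduces to `v ⇨ₗ w`.
  fun φ φ' => ((functionSpaceStr_unit X φ φ').le.trans (iInf_le _ x)).trans
    (congrArg (· ⇨ₗ (φ'.toFun x : V)) (𝕋.ξ_e (φ.toFun x : V))).ge

/-- Evaluation at `x` is a morphism of `𝕋`-graphs `V ^ X → V`. -/
theorem evalAt_isGraphMorphism (X : TCat 𝕋) (x : X.carrier) :
    IsGraphMorphism (functionSpace X) (quantaleTCat 𝕋).toTGraph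
      (fun φ : VFun X => (φ.toFun x : V)) := by
  refine (isGraphMorphism_quantale_iff _ _).2 fun 𝔭 φ => ?_
  -- The function space structure bounds every element of `T (X × V ^ X)` lying over `𝔭`; the one
  -- used here is concentrated on the slice `{x} × V ^ X`.
  have h := functionSpaceStr_le (𝕋.map (fun φ : VFun X => (x, φ)) 𝔭) φ x
  -- The second projection gives back `𝔭`, the first is constant and so sends everything to `e x` by
  -- `T 1 = 1`, and `ev` restricted to the slice is evaluation at `x`.
  simp only [𝕋.map_map, 𝕋.map_id, 𝕋.map_const] at h
  refine (mul_le_mul_right ?_ _).trans h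
  -- The extra factor `X.str (e x) x` in `h` is harmless since it lies above the unit.
  calc _ = 1 * _ := (one_mul _).symm
    _ ≤ _ := mul_le_mul_left (X.refl x) _

/-- Evaluation at `x` as a `𝕋`-frame homomorphism `Ω X → V`. -/
def evalAt (X : TCat 𝕋) (x : X.carrier) : OmegaObj X ⟶ quantaleTFrm 𝕋 :=
  TFrm.Hom.mk (A := OmegaObj X) (B := quantaleTFrm 𝕋)
    (fun φ : VFun X => (φ.toFun x : V))
    (evalAt_isVFunctor X x)
    -- Evaluation is a graph morphism on the whole of `V ^ X`, so composing it with any graph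
    -- morphism out of an algebra is enough.
    (fun _ _ hh => TCat.isGraphMorphism_comp hh (evalAt_isGraphMorphism X x))
    (fun I r φ h _ _ l hl => by
      have := ((functionSpacePresentation X).isLimit_iff _ φ h l).1 hl
      exact ((quantalePresentation 𝕋).isLimit_iff _ φ _ _).2 fun _ => this x)
    (fun I r h ψ hd c hc => by
      have h1 := ((functionSpacePresentation X).isColimit_iff _ I r h ψ hd c).1 hc
      obtain ⟨hd1, hd2, t, ht, hg⟩ := hd
      -- The pointwise criterion applies to `𝕋`-weighted diagrams only, so the evaluated diagram in
      -- `V` must be shown to be one; its tensors are the values at `x` of the tensors `t i` in `V ^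
      -- X`.
      refine ((quantalePresentation 𝕋).isColimit_iff _ I r _ ψ
        ⟨fun i j => (hd1 i j).trans (evalAt_isVFunctor X x (h i) (h j)), hd2,
          fun i => (t i).toFun x, fun i => ?_, ?_⟩ _).2 fun _ => h1 x
      · have := ((functionSpacePresentation X).isTensor_iff _ _ _ _).1 (ht i)
        exact ((quantalePresentation 𝕋).isTensor_iff _ _ _ _).2 fun _ => this x
      · exact TCat.isGraphMorphism_comp hg (evalAt_isGraphMorphism X x))

/-- The `𝕋`-functor `X → pt (Ω X)` that sends a point to its evaluation. -/
def evalUnit (X : TCat 𝕋) : X ⟶ ptObj (OmegaObj X) :=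
  TCat.Hom.mk (X := X) (Y := ptObj (OmegaObj X)) (evalAt X)
    -- Evaluating `ev_x` at `φ` gives `φ x`, so the condition to check for each `φ` is its own
    -- `𝕋`-functoriality.
    (le_ptStr (OmegaObj X) X (evalAt X) fun φ : VFun X => φ.isGraphMorphism)

end Evaluation

end TFrames

theorem mainTheorem6 {V : Type u} [CommMonoid V] [CompleteLattice V] [IsQuantale V]
    (𝕋 : StrictTopologicalTheory V) [Subsingleton (𝕋.T PUnit.{u + 1})] :
    ∃ η : 𝟭 (TCat 𝕋) ⟶ (Omega 𝕋).rightOp ⋙ pt 𝕋,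
      ∀ (X : TCat 𝕋) (x : X.carrier) (φ : X ⟶ quantaleTCat 𝕋),
        TFrm.Hom.toFun (A := (Omega 𝕋).obj (Opposite.op X)) (B := quantaleTFrm 𝕋)
          (TCat.Hom.toFun (η.app X) x) φ = TCat.Hom.toFun φ x :=
  -- For `f : X ⟶ Y`, both ways around the naturality square send `x` to the homomorphism `φ ↦ φ (f
  -- x)`: one evaluates `φ` at `f x`, the other evaluates `f ≫ φ` at `x`. These agree by definition.
  ⟨{ app := evalUnit, naturality := fun _ _ _ => rfl }, fun _ _ _ => rfl⟩
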